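/- \textbf{Model.} There are machine types $1,\dots,M$ ($M\ge 1$) with capacities $0<g_1<\dots<g_M$ and cost rates $0<c_1<\dots<c_M$, and unlimitedly many machines of each type. A finite list $\mathcal J$ of jobs is given; job $J$ has a size $s(J)$ with $0<s(J)\le g_M$ and an active interval $I(J)=[I(J)^-,I(J)^+)$ with $I(J)^-<I(J)^+$. A schedule places every job on one machine so that at every time the total size of the active jobs on a machine is at most its capacity. A machine of type $z$ costs $c_z$ times its busy time (the Lebesgue measure of the set of times at which it runs at least one job). $\mathrm{OPT}_{\mathrm{BSHM}}(\mathcal J)$ is the minimum total cost of a schedule, and $\mu=\max_J \mathrm{len}(J)/\min_J \mathrm{len}(J)$, where $\mathrm{len}(J)=I(J)^+-I(J)^-$. \textbf{Algorithm.} Let $r_z$ be the power $8^n$ ($n\in\mathbb Z$) with $\frac18 r_z<c_z\le r_z$ (so $r_z=c_z$ if the rates are powers of $8$). Let $p(i)=\min\{j>i: r_j/g_j<r_i/g_i\}$, if this set is nonempty, be the parent of type $i$; let $P(z)$ consist of $z$ and its ancestors and let $A_z=\{x: z\in P(x)\}$. Jobs are released one at a time in order of nondecreasing start time (ties in list order).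 A machine is open while it runs at least one job; once it closes it is not used again. When $J$ is released, $\mathrm{ALG}_{\mathrm{online}}$ starts with $z=m(J):=\min\{z: s(J)\le g_z\}$ and repeats: (i) if some open type-$z$ machine has available capacity at least $s(J)$, place $J$ on the one of these that was opened earliest; (ii) otherwise, if $z$ has no parent, or if $\sum_{x\in A_a\setminus\{a\}} n_x r_x<r_a-r_z$ for every $a\in P(z)\setminus\{z\}$, where $n_x$ is the number of type-$x$ machines currently open, place $J$ on a new type-$z$ machine; (iii) otherwise replace $z$ by $p(z)$. \textbf{Theorem.} There is an absolute constant $C>0$ such that for all machine types and all nonempty job lists $\mathcal J$ as above, $\mathrm{ALG}_{\mathrm{online}}$ produces a schedule for $\mathcal J$, and its total cost with respect to the rates $c_z$ is at most $C\,\mu\,\mathrm{OPT}_{\mathrm{BSHM}}(\mathcal J)$. -/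

import Mathlib

namespace BSHM

/-- A job: its size and its active interval `[start, finish)`. -/
structure Job where
  size : ℝ
  start : ℝ
  finish : ℝ

/-- The length of a job. -/
def Job.len (J : Job) : ℝ := J.finish - J.start

/-- The job `J` is active at time `t`, i.e. `t` lies in `[start, finish)`. -/
def Job.Active (J : Job) (t : ℝ) : Prop := J.start ≤ t ∧ t < J.finish

/-- The max/min job length ratio of a (nonempty) list of jobs. -/
noncomputable def lengthRatio (L : List Job) : ℝ :=
  sSup (Job.len '' {J | J ∈ L}) / sInf (Job.len '' {J | J ∈ L})

/-- With machine types indexed by `Fin M`, a machine is a type together with a serial number;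
there are infinitely many machines of each type. -/
abbrev Machine (M : ℕ) := Fin M × ℕ

/-- A placement of jobs on machines: each job together with the machine that runs it. -/
abbrev Placement (M : ℕ) := List (Job × Machine M)

section Schedules

variable {M : ℕ}

open Classical in
/-- The total size of the jobs running on machine `m` at time `t`. -/
noncomputable def load (S : Placement M) (m : Machine M) (t : ℝ) : ℝ :=
  ((S.filter (fun p => p.2 = m ∧ p.1.Active t)).map (fun p => p.1.size)).sum

/-- The times at which machine `m` processes at least one job. -/
def busySet (S : Placement M) (m : Machine M) : Set ℝ :=
  {t | ∃ p ∈ S, p.2 = m ∧ p.1.Active t}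

/-- `S` is a schedule for the jobs `L` on machines with capacities `g`: every job of `L` is placed
on exactly one machine, and no machine is ever loaded beyond its capacity. -/
def IsSchedule (g : Fin M → ℝ) (L : List Job) (S : Placement M) : Prop :=
  S.map Prod.fst = L ∧ ∀ (m : Machine M) (t : ℝ), load S m t ≤ g m.1

/-- The cost of a placement when a machine of type `z` is charged at rate `c z` for its busy
time. -/
noncomputable def cost (c : Fin M → ℝ) (S : Placement M) : ℝ :=
  ∑ m ∈ (S.map Prod.snd).toFinset, c m.1 * (MeasureTheory.volume (busySet S m)).toReal

/-- The optimal cost of scheduling the jobs `L` with capacities `g` and cost rates `c`. -/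
noncomputable def opt (g c : Fin M → ℝ) (L : List Job) : ℝ :=
  sInf {x | ∃ S : Placement M, IsSchedule g L S ∧ cost c S = x}

end Schedules

section Graph

variable {M : ℕ}

open Classical in
/-- The parent of type `i` in the cost-per-capacity graph: the lowest-indexed type above `i` with a
lower cost rate per unit of capacity, if there is one. -/
noncomputable def parent (g r : Fin M → ℝ) (i : Fin M) : Option (Fin M) :=
  if h : (Finset.univ.filter (fun j : Fin M => i < j ∧ r j / g j < r i / g i)).Nonempty then
    some ((Finset.univ.filter (fun j : Fin M => i < j ∧ r j / g j < r i / g i)).min' h)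
  else none

theorem lt_of_parent_eq_some {g r : Fin M → ℝ} {i j : Fin M} (h : parent g r i = some j) :
    i < j := by
  classical
  unfold parent at h
  split_ifs at h with hne
  have hmem := Finset.min'_mem _ hne
  rw [Option.some.inj h] at hmem
  exact (Finset.mem_filter.mp hmem).2.1

/-- `StrictAnc g r a z`: the node `a` is a proper ancestor of `z`, that is, `a` is one of
`p(z), p(p(z)), …`. Equivalently `z` is in the tree rooted at `a` and `z ≠ a`. -/
def StrictAnc (g r : Fin M → ℝ) (a z : Fin M) : Prop :=
  Relation.TransGen (fun x y => parent g r x = some y) z a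

open Classical in
/-- The exact machine type of a job of size `s`: the lowest-indexed type that can accommodate it
(type `0` as a default if there is none). -/
noncomputable def exactType [NeZero M] (g : Fin M → ℝ) (s : ℝ) : Fin M :=
  if h : (Finset.univ.filter (fun z : Fin M => s ≤ g z)).Nonempty then
    (Finset.univ.filter (fun z : Fin M => s ≤ g z)).min' h
  else 0

end Graph

section Online

variable {M : ℕ}

open Classical in
/-- The serial numbers of the type-`z` machines that are open (run some job) at time `t`. -/
noncomputable def openSerials (S : Placement M) (z : Fin M) (t : ℝ) : Finset ℕ :=
  ((S.filter (fun p => p.2.1 = z ∧ p.1.Active t)).map (fun p => p.2.2)).toFinset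

open Classical in
/-- The serial numbers of the type-`z` machines that are open at time `t` and have available
capacity at least `s`. -/
noncomputable def fitting (g : Fin M → ℝ) (S : Placement M) (s t : ℝ) (z : Fin M) : Finset ℕ :=
  (openSerials S z t).filter (fun k => load S (z, k) t + s ≤ g z)

open Classical in
/-- The total cost rate of the machines open at time `t` of types in the tree rooted at `a`,
the type `a` itself excluded. -/
noncomputable def subtreeRate (g r : Fin M → ℝ) (S : Placement M) (t : ℝ) (a : Fin M) : ℝ :=
  ∑ x ∈ Finset.univ.filter (fun x => StrictAnc g r a x), ((openSerials S x t).card : ℝ) * r x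

/-- The test for opening a new type-`z` machine at time `t`. -/
def MayOpen (g r : Fin M → ℝ) (S : Placement M) (t : ℝ) (z : Fin M) : Prop :=
  parent g r z = none ∨ ∀ a, StrictAnc g r a z → subtreeRate g r S t a < r a - r z

open Classical in
/-- The loop of the online algorithm, entered with current type `z`, for a job of size `s` released
at time `t` when the jobs released before are placed by `S`. A new machine receives as serial number
the number of jobs released before, so that serial numbers are fresh and increase in the order in
which machines are opened. -/
noncomputable def select (g r : Fin M → ℝ) (S : Placement M) (s t : ℝ) (z : Fin M) : Machine M :=
  if h : (fitting g S s t z).Nonempty then (z, (fitting g S s t z).min' h)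
  else if MayOpen g r S t z then (z, S.length)
  else
    match hp : parent g r z with
    | some y => select g r S s t y
    | none => (z, S.length)
termination_by M - z.val
decreasing_by
  have h1 : z.val < y.val := lt_of_parent_eq_some hp
  have h2 := y.isLt
  omega

/-- One step of the online algorithm: the job `J` is released and placed. The finish time of `J` is
not used, and those of the earlier jobs are used only to see which of them are still active. -/
noncomputable def onlineStep [NeZero M] (g r : Fin M → ℝ) (S : Placement M) (J : Job) :
    Placement M :=
  S ++ [(J, select g r S J.size J.start (exactType g J.size))]

/-- The placement computed by the online algorithm for jobs released one at a time in the order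
of the list. -/
noncomputable def algOnline [NeZero M] (g r : Fin M → ℝ) (L : List Job) : Placement M :=
  L.foldl (onlineStep g r) []

end Online

end BSHM

/-! Cost is the integral over time of the rates of the busy machines. For an arbitrary schedule `B`
it therefore suffices to bound the algorithm's rate at each `τ` by twelve times the rates of `B`,
summed over grid points `τ - k * ℓ`, where `ℓ` is the shortest job length. Every job met in a window
of two maximal job lengths before `τ` is active at a grid point (`exists_active_grid`). There are at
most `4μ` grid points and integration is translation invariant, which gives the factor `μ`; rounding
the rates costs a factor of eight.

For the pointwise bound (`sum_open_le_sampledRate`), let `j` be the highest type that `B` uses for a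
sampled job, so that `r j` is at most the sampled rate. Types with a parent at most `j` lie below
roots at most `j`. The opening test keeps the rate below each root under the root's own rate, and
the root rates form a geometric sum bounded by a multiple of `r j`. On any other type, first fit
half-fills the machines once two are open, and `B` runs the same jobs no more cheaply per unit of
capacity. This leaves at most one machine of each type: those up to `j` are again roots, and those
above `j` form a chain of increasing rates.

The top of that chain is bounded in `rate_le_of_open`. A job climbs above `j` only because openings
lower down were denied, so at its start some subtree was already nearly full. That subtree is
bounded by the same accounting, and powers of eight make the self-referential term small enough to
absorb. Looking back to the start of a job active at `τ` is why the window has two job lengths. -/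

namespace BSHM

/-! ### The cost-per-capacity forest -/

section Forest

variable {M : ℕ} {g r : Fin M → ℝ}

theorem parent_eq_some_iff {i j : Fin M} :
    parent g r i = some j ↔
      i < j ∧ r j / g j < r i / g i ∧ ∀ y, i < y → y < j → r i / g i ≤ r y / g y := by
  classical
  unfold parent
  constructor
  · intro h
    split_ifs at h with hne
    have hj := Option.some.inj h
    have hmem := Finset.min'_mem _ hne
    rw [hj] at hmem
    obtain ⟨h1, h2⟩ := (Finset.mem_filter.mp hmem).2
    refine ⟨h1, h2, fun y hy hyj => ?_⟩
    by_contra! hlt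
    have := Finset.min'_le (Finset.univ.filter (fun j : Fin M => i < j ∧ r j / g j < r i / g i)) y
      (Finset.mem_filter.mpr ⟨Finset.mem_univ _, hy, hlt⟩)
    rw [hj] at this
    exact absurd hyj (not_lt.mpr this)
  · rintro ⟨h1, h2, h3⟩
    have hmem : j ∈ Finset.univ.filter (fun j : Fin M => i < j ∧ r j / g j < r i / g i) :=
      Finset.mem_filter.mpr ⟨Finset.mem_univ _, h1, h2⟩
    have hne : (Finset.univ.filter
        (fun j : Fin M => i < j ∧ r j / g j < r i / g i)).Nonempty := ⟨j, hmem⟩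
    rw [dif_pos hne]
    congr 1
    refine le_antisymm (Finset.min'_le _ _ hmem) (Finset.le_min' _ _ _ fun y hy => ?_)
    obtain ⟨hy1, hy2⟩ := (Finset.mem_filter.mp hy).2
    by_contra! hlt
    exact absurd hy2 (not_lt.mpr (h3 y hy1 hlt))

theorem exists_parent {i j : Fin M} (hij : i < j) (h : r j / g j < r i / g i) :
    ∃ p, parent g r i = some p ∧ p ≤ j := by
  classical
  have hmem : j ∈ Finset.univ.filter (fun j : Fin M => i < j ∧ r j / g j < r i / g i) :=
    Finset.mem_filter.mpr ⟨Finset.mem_univ _, hij, h⟩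
  unfold parent
  rw [dif_pos ⟨j, hmem⟩]
  exact ⟨_, rfl, Finset.min'_le _ _ hmem⟩

/-- The tree rooted at `a` is an interval of types ending at `a`, and `a` is its most cost-effective
type. -/
theorem strictAnc_iff {a z : Fin M} :
    StrictAnc g r a z ↔ z < a ∧ ∀ y, z ≤ y → y < a → r a / g a < r y / g y := by
  constructor
  · intro h
    have step : ∀ {x p : Fin M}, parent g r x = some p →
        x < p ∧ ∀ y, x ≤ y → y < p → r p / g p < r y / g y := by
      intro x p hp
      obtain ⟨h1, h2, h3⟩ := parent_eq_some_iff.mp hp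
      refine ⟨h1, fun y hy hyp => ?_⟩
      rcases hy.eq_or_lt with rfl | hlt
      · exact h2
      · exact h2.trans_le (h3 y hlt hyp)
    induction h with
    | single hp => exact step hp
    | tail _ hp ih =>
      obtain ⟨h1, h2⟩ := step hp
      refine ⟨ih.1.trans h1, fun y hy hya => ?_⟩
      rcases lt_or_ge y _ with hlt | hge
      · exact (h2 _ le_rfl h1).trans (ih.2 y hy hlt)
      · exact h2 y hge hya
  · rintro ⟨hza, h⟩
    -- Induction on the distance to `a`: the parent of `z` cannot jump over `a`, since `a` is itself
    -- a better type than `z`.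
    have key : ∀ d : ℕ, ∀ z : Fin M, a.val - z.val ≤ d → z < a →
        (∀ y, z ≤ y → y < a → r a / g a < r y / g y) → StrictAnc g r a z := by
      intro d
      induction d with
      | zero =>
        intro z hd hza _
        have : z.val < a.val := hza
        omega
      | succ d ih =>
        intro z hd hza h
        obtain ⟨p, hp, hpa⟩ := exists_parent hza (h z le_rfl hza)
        rcases hpa.eq_or_lt with rfl | hlt
        · exact Relation.TransGen.single hp
        · have hzp : z < p := lt_of_parent_eq_some hp
          refine Relation.TransGen.head hp (ih p ?_ hlt fun y hy hya => h y (hzp.le.trans hy) hya)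
          have h1 : z.val < p.val := hzp
          omega
    exact key _ z le_rfl hza h

theorem not_strictAnc_of_parent_eq_none {a z : Fin M} (h : parent g r z = none) :
    ¬ StrictAnc g r a z := by
  intro ha
  obtain ⟨h1, h2⟩ := strictAnc_iff.mp ha
  obtain ⟨p, hp, _⟩ := exists_parent h1 (h2 z le_rfl h1)
  rw [h] at hp
  cases hp

theorem StrictAnc.eq_or_of_parent {a z p : Fin M} (ha : StrictAnc g r a z)
    (hp : parent g r z = some p) : a = p ∨ StrictAnc g r a p := by
  obtain ⟨h1, h2⟩ := strictAnc_iff.mp ha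
  obtain ⟨q, hq, hqa⟩ := exists_parent h1 (h2 z le_rfl h1)
  rw [hp] at hq
  cases hq
  rcases hqa.eq_or_lt with h | h
  · exact Or.inl h.symm
  · exact Or.inr (strictAnc_iff.mpr
      ⟨h, fun y hy hya => h2 y ((lt_of_parent_eq_some hp).le.trans hy) hya⟩)

/-- The order of two types of equal rate forces the lower one to have a parent no higher than the
other one. -/
theorem exists_parent_of_eq (hg : ∀ z, 0 < g z) (hgm : StrictMono g) (hr : ∀ z, 0 < r z)
    {x y : Fin M} (hxy : x < y) (h : r y ≤ r x) : ∃ p, parent g r x = some p ∧ p ≤ y :=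
  exists_parent hxy <| (div_le_div_of_nonneg_right h (hg y).le).trans_lt
    (div_lt_div_of_pos_left (hr x) (hg x) (hgm hxy))

theorem exactType_le [NeZero M] {s : ℝ} {y : Fin M} (h : s ≤ g y) : exactType g s ≤ y := by
  classical
  have hmem : y ∈ Finset.univ.filter (fun z : Fin M => s ≤ g z) :=
    Finset.mem_filter.mpr ⟨Finset.mem_univ _, h⟩
  unfold exactType
  rw [dif_pos ⟨y, hmem⟩]
  exact Finset.min'_le _ _ hmem

theorem le_capacity_exactType [NeZero M] {s : ℝ} (h : ∃ z, s ≤ g z) : s ≤ g (exactType g s) := by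
  classical
  obtain ⟨y, hy⟩ := h
  have hmem : y ∈ Finset.univ.filter (fun z : Fin M => s ≤ g z) :=
    Finset.mem_filter.mpr ⟨Finset.mem_univ _, hy⟩
  unfold exactType
  rw [dif_pos ⟨y, hmem⟩]
  exact (Finset.mem_filter.mp (Finset.min'_mem _ ⟨y, hmem⟩)).2

end Forest

/-! ### Geometric sums of rates -/

section PowersOfEight

variable {M : ℕ} {r : Fin M → ℝ}

theorem zpow_eight_le_div {a b : ℤ} (h : (8 : ℝ) ^ a < 8 ^ b) : (8 : ℝ) ^ a ≤ 8 ^ b / 8 := by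
  have hab : a < b := (zpow_lt_zpow_iff_right₀ (by norm_num : (1 : ℝ) < 8)).mp h
  have h8 : (8 : ℝ) ^ b / 8 = 8 ^ (b - 1) := by
    rw [zpow_sub_one₀ (by norm_num : (8 : ℝ) ≠ 0), div_eq_mul_inv]
  rw [h8]
  exact zpow_le_zpow_right₀ (by norm_num) (by omega)

theorem rate_le_div (hr : ∀ z, ∃ n : ℤ, r z = (8 : ℝ) ^ n) {x y : Fin M} (h : r x < r y) :
    r x ≤ r y / 8 := by
  obtain ⟨a, ha⟩ := hr x
  obtain ⟨b, hb⟩ := hr y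
  rw [ha, hb] at h ⊢
  exact zpow_eight_le_div h

/-- A geometric sum: powers of eight which increase strictly along `Y` add up to at most `8 / 7`
times any upper bound for them. -/
theorem sum_rate_le (hr : ∀ z, ∃ n : ℤ, r z = (8 : ℝ) ^ n) (Y : Finset (Fin M)) :
    ∀ R : ℝ, 0 ≤ R → (∀ x ∈ Y, ∀ y ∈ Y, x < y → r x < r y) → (∀ y ∈ Y, r y ≤ R) →
      ∑ y ∈ Y, r y ≤ 8 / 7 * R := by
  induction Y using Finset.induction_on_max with
  | empty =>
    intro R hR _ _
    simpa using hR
  | insert a Y hmax ih =>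
    intro R _ hmono hle
    have ha : a ∉ Y := fun h => lt_irrefl _ (hmax a h)
    have hra : 0 < r a := by
      obtain ⟨n, hn⟩ := hr a
      rw [hn]
      positivity
    -- All rates below the maximal element are at most `r a / 8`, and `8/7 * (1/8) + 1 = 8/7`.
    have h1 := ih (r a / 8) (by positivity)
      (fun x hx y hy => hmono x (Finset.mem_insert_of_mem hx) y (Finset.mem_insert_of_mem hy))
      (fun y hy => rate_le_div hr (hmono y (Finset.mem_insert_of_mem hy) a
        (Finset.mem_insert_self _ _) (hmax y hy)))
    have h2 := hle a (Finset.mem_insert_self _ _)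
    rw [Finset.sum_insert ha]
    linarith

end PowersOfEight

/-! ### Loads and open machines -/

section Placements

variable {M : ℕ} {g r : Fin M → ℝ}

theorem mem_openSerials {S : Placement M} {z : Fin M} {t : ℝ} {k : ℕ} :
    k ∈ openSerials S z t ↔ ∃ p ∈ S, p.2 = (z, k) ∧ p.1.Active t := by
  classical
  unfold openSerials
  simp only [List.mem_toFinset, List.mem_map, List.mem_filter, decide_eq_true_eq]
  constructor
  · rintro ⟨p, ⟨hp, hz, ht⟩, hk⟩
    exact ⟨p, hp, Prod.ext hz hk, ht⟩
  · rintro ⟨p, hp, hm, ht⟩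
    exact ⟨p, ⟨hp, by rw [hm], ht⟩, by rw [hm]⟩

theorem openSerials_mono {S S' : Placement M} (h : S ⊆ S') (z : Fin M) (t : ℝ) :
    openSerials S z t ⊆ openSerials S' z t := fun k hk => by
  obtain ⟨p, hp, h1⟩ := mem_openSerials.mp hk
  exact mem_openSerials.mpr ⟨p, h hp, h1⟩

/-- Once all jobs have started, machines can only close. Hence later times reduce to the release
time of the current job. -/
theorem openSerials_subset_of_start_le {S : Placement M} {t₀ t : ℝ} (ht : t₀ ≤ t)
    (hS : ∀ p ∈ S, p.1.start ≤ t₀) (z : Fin M) : openSerials S z t ⊆ openSerials S z t₀ :=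
  fun k hk => by
    obtain ⟨p, hp, h1, h2⟩ := mem_openSerials.mp hk
    exact mem_openSerials.mpr ⟨p, hp, h1, hS p hp, ht.trans_lt h2.2⟩

theorem mem_openSerials_append {S : Placement M} {p : Job × Machine M} {z : Fin M} {t : ℝ}
    {k : ℕ} : k ∈ openSerials (S ++ [p]) z t ↔
      k ∈ openSerials S z t ∨ (p.2 = (z, k) ∧ p.1.Active t) := by
  simp only [mem_openSerials, List.mem_append, List.mem_singleton]
  constructor
  · rintro ⟨q, hq | rfl, h⟩
    · exact Or.inl ⟨q, hq, h⟩
    · exact Or.inr h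
  · rintro (⟨q, hq, h⟩ | h)
    · exact ⟨q, Or.inl hq, h⟩
    · exact ⟨p, Or.inr rfl, h⟩

theorem subtreeRate_mono (hr : ∀ z, 0 < r z) {S S' : Placement M} {t t' : ℝ}
    (h : ∀ z, openSerials S z t ⊆ openSerials S' z t') (a : Fin M) :
    subtreeRate g r S t a ≤ subtreeRate g r S' t' a := by
  unfold subtreeRate
  refine Finset.sum_le_sum fun x _ => ?_
  have := Finset.card_le_card (h x)
  have h' : ((openSerials S x t).card : ℝ) ≤ (openSerials S' x t').card := by exact_mod_cast this
  exact mul_le_mul_of_nonneg_right h' (hr x).le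

open Classical in
theorem load_append (S : Placement M) (p : Job × Machine M) (m : Machine M) (t : ℝ) :
    load (S ++ [p]) m t = load S m t + if p.2 = m ∧ p.1.Active t then p.1.size else 0 := by
  unfold load
  rw [List.filter_append, List.map_append, List.sum_append]
  congr 1
  by_cases h : p.2 = m ∧ p.1.Active t <;> simp [h]

theorem load_le_load_append {S : Placement M} {p : Job × Machine M} (hp : 0 < p.1.size)
    (m : Machine M) (t : ℝ) : load S m t ≤ load (S ++ [p]) m t := by
  classical
  rw [load_append]
  split_ifs
  · linarith
  · linarith

/-- After the last start jobs only leave, so checking capacity at the release time is enough for all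
later times. -/
theorem load_antitone {S : Placement M} (hpos : ∀ p ∈ S, 0 < p.1.size) {t₀ t : ℝ} (ht : t₀ ≤ t)
    (hS : ∀ p ∈ S, p.1.start ≤ t₀) (m : Machine M) : load S m t ≤ load S m t₀ := by
  induction S using List.reverseRecOn with
  | nil => simp [load]
  | append_singleton S p ih =>
    classical
    have h1 := ih (fun q hq => hpos q (by simp [hq])) (fun q hq => hS q (by simp [hq]))
    rw [load_append, load_append]
    have hp := hpos p (by simp)
    have hp' := hS p (by simp)
    have : p.1.Active t → p.1.Active t₀ := fun h => ⟨hp', ht.trans_lt h.2⟩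
    split_ifs with h2 h3 <;> first | tauto | linarith

theorem load_eq_zero {S : Placement M} {m : Machine M} {t : ℝ} (h : ∀ p ∈ S, p.2 ≠ m) :
    load S m t = 0 := by
  classical
  unfold load
  rw [List.filter_eq_nil_iff.mpr]
  · simp
  · intro p hp
    simp [h p hp]

end Placements

/-! ### Invariants of the online algorithm -/

section Algorithm

variable {M : ℕ} {g r : Fin M → ℝ}

/-- The machine selected by the loop of the algorithm: its type lies on the path that starts at `z`,
all the types passed on the way were not allowed to open a machine, and the machine is the first
one that fits or else a new one. -/
theorem select_spec (S : Placement M) (s t : ℝ) (z : Fin M) :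
    ((select g r S s t z).1 = z ∨ StrictAnc g r (select g r S s t z).1 z) ∧
    (∀ y, (y = z ∨ StrictAnc g r y z) → StrictAnc g r (select g r S s t z).1 y →
      ¬ MayOpen g r S t y) ∧
    (((select g r S s t z).2 ∈ fitting g S s t (select g r S s t z).1 ∧
      ∀ k ∈ fitting g S s t (select g r S s t z).1, (select g r S s t z).2 ≤ k) ∨
     (fitting g S s t (select g r S s t z).1 = ∅ ∧ (select g r S s t z).2 = S.length ∧
      MayOpen g r S t (select g r S s t z).1)) := by
  have irr : ∀ {x y : Fin M}, (x = y ∨ StrictAnc g r x y) → StrictAnc g r y x → False := by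
    intro x y h1 h2
    have := (strictAnc_iff.mp h2).1
    rcases h1 with rfl | h1
    · exact lt_irrefl _ this
    · exact lt_asymm this (strictAnc_iff.mp h1).1
  -- Induction on a bound for the termination measure of `select`.
  have key : ∀ d : ℕ, ∀ z : Fin M, M - z.val ≤ d → ∀ m, select g r S s t z = m →
    ((m.1 = z ∨ StrictAnc g r m.1 z) ∧
    (∀ y, (y = z ∨ StrictAnc g r y z) → StrictAnc g r m.1 y → ¬ MayOpen g r S t y) ∧
    ((m.2 ∈ fitting g S s t m.1 ∧ ∀ k ∈ fitting g S s t m.1, m.2 ≤ k) ∨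
     (fitting g S s t m.1 = ∅ ∧ m.2 = S.length ∧ MayOpen g r S t m.1))) := by
    intro d
    induction d with
    | zero =>
      intro z hz
      have := z.isLt
      omega
    | succ d ih =>
      intro z hz m hm
      rw [select] at hm
      split_ifs at hm with h1 h2
      · subst hm
        exact ⟨Or.inl rfl, fun y hy hy' => (irr hy hy').elim,
          Or.inl ⟨Finset.min'_mem _ h1, fun k hk => Finset.min'_le _ _ hk⟩⟩
      · subst hm
        exact ⟨Or.inl rfl, fun y hy hy' => (irr hy hy').elim,
          Or.inr ⟨Finset.not_nonempty_iff_eq_empty.mp h1, rfl, h2⟩⟩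
      · split at hm
        · rename_i y hp
          have hzy : z.val < y.val := lt_of_parent_eq_some hp
          obtain ⟨i1, i2, i3⟩ := ih y (by omega) m hm
          refine ⟨Or.inr ?_, fun x hx hx' => ?_, i3⟩
          · rcases i1 with i1 | i1
            · rw [i1]
              exact Relation.TransGen.single hp
            · exact Relation.TransGen.head hp i1
          · rcases hx with rfl | hx
            · exact h2
            · exact i2 x (hx.eq_or_of_parent hp) hx'
        · rename_i hp
          exact absurd (Or.inl hp) h2
  exact key _ z le_rfl _ rfl

/-- What is known about the placement computed by the online algorithm. -/
structure Invariant [NeZero M] (g r : Fin M → ℝ) (L : List Job) (S : Placement M) : Prop where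
  map_fst : S.map Prod.fst = L
  load_le : ∀ m t, load S m t ≤ g m.1
  serial_lt : ∀ p ∈ S, p.2.2 < S.length
  subtreeRate_lt : ∀ a t, subtreeRate g r S t a < r a
  path : ∀ p ∈ S, p.2.1 = exactType g p.1.size ∨ StrictAnc g r p.2.1 (exactType g p.1.size)
  denied : ∀ p ∈ S, ∀ z, (z = exactType g p.1.size ∨ StrictAnc g r z (exactType g p.1.size)) →
    StrictAnc g r p.2.1 z →
    ∃ a, StrictAnc g r a z ∧ r a - r z ≤ subtreeRate g r S p.1.start a
  firstFit : ∀ p ∈ S, ∀ t, p.1.Active t → ∀ k ∈ openSerials S p.2.1 t, k < p.2.2 →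
    g p.2.1 < load S (p.2.1, k) p.1.start + p.1.size

/-- A new machine adds its rate exactly to the subtrees of its strict ancestors, which are the ones
tested by `MayOpen`; a type without a parent has none. The lower bounds in `denied` and `firstFit`
survive because appending a job only enlarges loads and open sets. -/
theorem Invariant.step [NeZero M] (hgm : StrictMono g) (hr : ∀ z, 0 < r z) {L : List Job}
    {S : Placement M} (h : Invariant g r L S) {J : Job} (hL : ∀ J' ∈ L, 0 < J'.size)
    (hJ : 0 < J.size) (hJ' : ∃ z, J.size ≤ g z) (hstart : ∀ J' ∈ L, J'.start ≤ J.start) :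
    Invariant g r (L ++ [J]) (onlineStep g r S J) := by
  have hmem : ∀ p ∈ S, p.1 ∈ L := fun p hp => by
    rw [← h.map_fst]
    exact List.mem_map_of_mem hp
  have hSpos : ∀ p ∈ S, 0 < p.1.size := fun p hp => hL _ (hmem p hp)
  have hSstart : ∀ p ∈ S, p.1.start ≤ J.start := fun p hp => hstart _ (hmem p hp)
  unfold onlineStep
  obtain ⟨s1, s2, s3⟩ := select_spec (g := g) (r := r) S J.size J.start (exactType g J.size)
  generalize select g r S J.size J.start (exactType g J.size) = m at s1 s2 s3
  obtain ⟨x, k₀⟩ := m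
  simp only at s1 s2 s3
  have hsub : S ⊆ S ++ [(J, (x, k₀))] := List.subset_append_left _ _
  have hfit : ∀ k, k ∈ fitting g S J.size J.start x ↔
      k ∈ openSerials S x J.start ∧ load S (x, k) J.start + J.size ≤ g x := fun k => by
    unfold fitting
    exact Finset.mem_filter
  have hexle : exactType g J.size ≤ x := by
    rcases s1 with s1 | s1
    · exact s1.ge
    · exact (strictAnc_iff.mp s1).1.le
  have hJx : J.size ≤ g x := (le_capacity_exactType hJ').trans (hgm.monotone hexle)
  -- A new machine has a serial number larger than all used ones, so its previous load is zero.
  have hload : load S (x, k₀) J.start + J.size ≤ g x := by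
    rcases s3 with ⟨s3, _⟩ | ⟨_, s3, _⟩
    · exact ((hfit k₀).mp s3).2
    · rw [load_eq_zero, zero_add]
      · exact hJx
      · intro p hp hpm
        have := h.serial_lt p hp
        rw [hpm] at this
        simp only at this
        omega
  constructor
  · rw [List.map_append, h.map_fst]
    rfl
  · intro m t
    classical
    rw [load_append]
    split_ifs with hc
    · obtain ⟨rfl, ht⟩ := hc
      have := load_antitone hSpos ht.1 hSstart (x, k₀)
      simp only at this ⊢
      linarith
    · simpa using h.load_le m t
  · intro p hp
    rw [List.length_append, List.length_singleton]
    rcases List.mem_append.mp hp with hp | hp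
    · have := h.serial_lt p hp
      omega
    · rw [List.mem_singleton] at hp
      subst hp
      rcases s3 with ⟨s3, _⟩ | ⟨_, s3, _⟩
      · obtain ⟨q, hq, hq', _⟩ := mem_openSerials.mp ((hfit k₀).mp s3).1
        have := h.serial_lt q hq
        rw [hq'] at this
        simp only at this ⊢
        omega
      · simp only
        omega
  · intro a t
    -- While `J` is active, compare with the state just before placing `J`, at time `J.start`; at
    -- other times the open machines are unchanged.
    by_cases ht : J.Active t
    · rcases s3 with ⟨s3, _⟩ | ⟨_, _, s3⟩
      · refine (subtreeRate_mono hr (fun z k hk => ?_) a).trans_lt (h.subtreeRate_lt a J.start)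
        rcases mem_openSerials_append.mp hk with hk | ⟨hk, _⟩
        · exact openSerials_subset_of_start_le ht.1 hSstart z hk
        · obtain ⟨rfl, rfl⟩ := Prod.mk.injEq _ _ _ _ ▸ hk
          exact ((hfit _).mp s3).1
      · have hother : ∀ z, z ≠ x →
            openSerials (S ++ [(J, (x, k₀))]) z t ⊆ openSerials S z J.start := by
          intro z hz k hk
          rcases mem_openSerials_append.mp hk with hk | ⟨hk, _⟩
          · exact openSerials_subset_of_start_le ht.1 hSstart z hk
          · exact absurd (congrArg Prod.fst hk).symm hz
        have hsame : ((openSerials (S ++ [(J, (x, k₀))]) x t).card : ℝ) ≤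
            (openSerials S x J.start).card + 1 := by
          have : openSerials (S ++ [(J, (x, k₀))]) x t ⊆
              insert k₀ (openSerials S x J.start) := by
            intro k hk
            rcases mem_openSerials_append.mp hk with hk | ⟨hk, _⟩
            · exact Finset.mem_insert_of_mem (openSerials_subset_of_start_le ht.1 hSstart x hk)
            · exact Finset.mem_insert.mpr (Or.inl (congrArg Prod.snd hk).symm)
          exact_mod_cast (Finset.card_le_card this).trans (Finset.card_insert_le _ _)
        by_cases hax : StrictAnc g r a x
        · have hlt : subtreeRate g r S J.start a < r a - r x := by
            rcases s3 with s3 | s3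
            · exact absurd hax (not_strictAnc_of_parent_eq_none s3)
            · exact s3 a hax
          have : subtreeRate g r (S ++ [(J, (x, k₀))]) t a ≤
              subtreeRate g r S J.start a + r x := by
            classical
            unfold subtreeRate
            have hx : x ∈ Finset.univ.filter (fun y => StrictAnc g r a y) :=
              Finset.mem_filter.mpr ⟨Finset.mem_univ _, hax⟩
            rw [← Finset.add_sum_erase _ _ hx, ← Finset.add_sum_erase _ _ hx]
            have h1 := mul_le_mul_of_nonneg_right hsame (hr x).le
            have h2 : ∑ y ∈ (Finset.univ.filter (fun y => StrictAnc g r a y)).erase x,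
                ((openSerials (S ++ [(J, (x, k₀))]) y t).card : ℝ) * r y ≤
                ∑ y ∈ (Finset.univ.filter (fun y => StrictAnc g r a y)).erase x,
                ((openSerials S y J.start).card : ℝ) * r y := by
              refine Finset.sum_le_sum fun y hy => ?_
              refine mul_le_mul_of_nonneg_right ?_ (hr y).le
              exact_mod_cast Finset.card_le_card (hother y (Finset.ne_of_mem_erase hy))
            linarith
          linarith
        · refine lt_of_le_of_lt ?_ (h.subtreeRate_lt a J.start)
          classical
          unfold subtreeRate
          refine Finset.sum_le_sum fun y hy => mul_le_mul_of_nonneg_right ?_ (hr y).le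
          refine Nat.cast_le.mpr (Finset.card_le_card (hother y ?_))
          rintro rfl
          exact hax (Finset.mem_filter.mp hy).2
    · refine (subtreeRate_mono hr (fun z k hk => ?_) a).trans_lt (h.subtreeRate_lt a t)
      rcases mem_openSerials_append.mp hk with hk | ⟨_, hk⟩
      · exact hk
      · exact absurd hk ht
  · intro p hp
    rcases List.mem_append.mp hp with hp | hp
    · exact h.path p hp
    · rw [List.mem_singleton] at hp
      subst hp
      exact s1
  · intro p hp z hz hz'
    have hmono : ∀ a t, subtreeRate g r S t a ≤ subtreeRate g r (S ++ [(J, (x, k₀))]) t a :=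
      fun a t => subtreeRate_mono hr (fun z => openSerials_mono hsub z t) a
    rcases List.mem_append.mp hp with hp | hp
    · obtain ⟨a, ha, ha'⟩ := h.denied p hp z hz hz'
      exact ⟨a, ha, ha'.trans (hmono a _)⟩
    · rw [List.mem_singleton] at hp
      subst hp
      have := s2 z hz hz'
      unfold MayOpen at this
      push Not at this
      obtain ⟨_, a, ha, ha'⟩ := this
      exact ⟨a, ha, ha'.trans (hmono a _)⟩
  · intro p hp t ht k hk hkp
    rcases List.mem_append.mp hp with hp | hp
    · have hkS : g p.2.1 < load S (p.2.1, k) p.1.start + p.1.size := by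
        rcases mem_openSerials_append.mp hk with hk | ⟨hk, hJt⟩
        · exact h.firstFit p hp t ht k hk hkp
        · have hx : x = p.2.1 := congrArg Prod.fst hk
          have hk₀ : k₀ = k := congrArg Prod.snd hk
          subst hk₀
          -- If `J` joined an open machine, that machine was open at `J.start`, while the job of `p`
          -- was still active, so the old first-fit clause applies at that time. A new machine would
          -- have a serial number above that of `p`.
          rcases s3 with ⟨s3, _⟩ | ⟨_, s3, _⟩
          · refine h.firstFit p hp J.start ⟨hSstart p hp, hJt.1.trans_lt ht.2⟩ _ ?_ hkp
            rw [← hx]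
            exact ((hfit _).mp s3).1
          · have := h.serial_lt p hp
            omega
      have := load_le_load_append (S := S) (p := (J, (x, k₀))) hJ (p.2.1, k) p.1.start
      linarith
    · rw [List.mem_singleton] at hp
      subst hp
      simp only at ht hk hkp ⊢
      have hk' : k ∈ openSerials S x J.start := by
        rcases mem_openSerials_append.mp hk with hk | ⟨hk, _⟩
        · exact openSerials_subset_of_start_le ht.1 hSstart x hk
        · have : k₀ = k := congrArg Prod.snd hk
          omega
      have hnot : k ∉ fitting g S J.size J.start x := by
        rcases s3 with ⟨_, s3⟩ | ⟨s3, _⟩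
        · intro hf
          have := s3 k hf
          omega
        · simp [s3]
      rw [hfit] at hnot
      have h1 : g x < load S (x, k) J.start + J.size := by
        by_contra! hle
        exact hnot ⟨hk', hle⟩
      have := load_le_load_append (S := S) (p := (J, (x, k₀))) hJ (x, k) J.start
      linarith

theorem algOnline_invariant [NeZero M] (hg : ∀ z, 0 < g z) (hgm : StrictMono g)
    (hr : ∀ z, 0 < r z) (L : List Job)
    (hL : ∀ J ∈ L, 0 < J.size ∧ (∃ z, J.size ≤ g z) ∧ J.start < J.finish)
    (hsorted : L.Pairwise (fun J J' => J.start ≤ J'.start)) :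
    Invariant g r L (algOnline g r L) := by
  induction L using List.reverseRecOn with
  | nil =>
    have : algOnline g r [] = [] := rfl
    rw [this]
    constructor
    · rfl
    · intro m t
      simpa [load] using (hg m.1).le
    · simp
    · intro a t
      simpa [subtreeRate, openSerials] using hr a
    all_goals simp
  | append_singleton L J ih =>
    have hstep : algOnline g r (L ++ [J]) = onlineStep g r (algOnline g r L) J := by
      simp [algOnline, List.foldl_append]
    rw [hstep]
    obtain ⟨h1, _, h2⟩ := List.pairwise_append.mp hsorted
    have hJ := hL J (by simp)
    exact (ih (fun J' hJ' => hL J' (by simp [hJ'])) h1).step hgm hr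
      (fun J' hJ' => (hL J' (by simp [hJ'])).1) hJ.1 hJ.2.1 (fun J' hJ' => h2 J' hJ' J (by simp))

end Algorithm

/-! ### Placements as functions on job indices, and total rates -/

section IndexedPlacements

variable {M n : ℕ}

/-- The placement that puts job number `i` on machine `A i`. -/
def placement (job : Fin n → Job) (A : Fin n → Machine M) : Placement M :=
  List.ofFn fun i => (job i, A i)

theorem mem_placement {job : Fin n → Job} {A : Fin n → Machine M} {p : Job × Machine M} :
    p ∈ placement job A ↔ ∃ i, (job i, A i) = p := by
  unfold placement
  exact List.mem_ofFn

open Classical in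
theorem load_ofFn (f : Fin n → Job × Machine M) (m : Machine M) (t : ℝ) :
    load (List.ofFn f) m t =
      ∑ i, if (f i).2 = m ∧ (f i).1.Active t then (f i).1.size else 0 := by
  induction n with
  | zero => simp [load]
  | succ n ih =>
    rw [List.ofFn_succ, Fin.sum_univ_succ, ← ih]
    unfold load
    by_cases h : (f 0).2 = m ∧ (f 0).1.Active t <;> simp [h]

open Classical in
theorem load_placement (job : Fin n → Job) (A : Fin n → Machine M) (m : Machine M) (t : ℝ) :
    load (placement job A) m t =
      ∑ i, if A i = m ∧ (job i).Active t then (job i).size else 0 :=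
  load_ofFn _ m t

theorem mem_openSerials_placement {job : Fin n → Job} {A : Fin n → Machine M} {z : Fin M} {t : ℝ}
    {k : ℕ} : k ∈ openSerials (placement job A) z t ↔ ∃ i, A i = (z, k) ∧ (job i).Active t := by
  rw [mem_openSerials]
  constructor
  · rintro ⟨p, hp, h⟩
    obtain ⟨i, rfl⟩ := mem_placement.mp hp
    exact ⟨i, h⟩
  · rintro ⟨i, h⟩
    exact ⟨_, mem_placement.mpr ⟨i, rfl⟩, h⟩

theorem mem_busySet_placement {job : Fin n → Job} {A : Fin n → Machine M} {m : Machine M} {t : ℝ} :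
    t ∈ busySet (placement job A) m ↔ ∃ i, A i = m ∧ (job i).Active t := by
  constructor
  · rintro ⟨p, hp, h⟩
    obtain ⟨i, rfl⟩ := mem_placement.mp hp
    exact ⟨i, h⟩
  · rintro ⟨i, h⟩
    exact ⟨_, mem_placement.mpr ⟨i, rfl⟩, h⟩

open Classical in
/-- The total rate of the machines which are busy at time `t`. -/
noncomputable def rateAt (r : Fin M → ℝ) (S : Placement M) (t : ℝ) : ℝ :=
  ∑ m ∈ (S.map Prod.snd).toFinset, if t ∈ busySet S m then r m.1 else 0

theorem rateAt_nonneg {r : Fin M → ℝ} (hr : ∀ z, 0 < r z) (S : Placement M) (t : ℝ) :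
    0 ≤ rateAt r S t := by
  classical
  refine Finset.sum_nonneg fun m _ => ?_
  split_ifs
  · exact (hr _).le
  · exact le_rfl

theorem machine_mem_placement (job : Fin n → Job) (A : Fin n → Machine M) (i : Fin n) :
    A i ∈ ((placement job A).map Prod.snd).toFinset :=
  List.mem_toFinset.mpr (List.mem_map.mpr ⟨_, mem_placement.mpr ⟨i, rfl⟩, rfl⟩)

theorem rate_le_rateAt {r : Fin M → ℝ} (hr : ∀ z, 0 < r z) {job : Fin n → Job}
    {A : Fin n → Machine M} {i : Fin n} {t : ℝ} (hi : (job i).Active t) :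
    r (A i).1 ≤ rateAt r (placement job A) t := by
  classical
  unfold rateAt
  have h1 : (if t ∈ busySet (placement job A) (A i) then r (A i).1 else 0) = r (A i).1 :=
    if_pos (mem_busySet_placement.mpr ⟨i, rfl, hi⟩)
  refine h1.ge.trans (Finset.single_le_sum (f := fun m : Machine M =>
    if t ∈ busySet (placement job A) m then r m.1 else 0) (fun m _ => ?_)
    (machine_mem_placement job A i))
  split_ifs
  · exact (hr _).le
  · exact le_rfl

open Classical in
/-- The sizes of the active jobs, weighted by the cost per unit of capacity of the machines that run
them, are paid for by the busy machines. -/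
theorem sum_size_mul_le_rateAt {g r : Fin M → ℝ} (hg : ∀ z, 0 < g z) (hr : ∀ z, 0 < r z)
    {job : Fin n → Job} {A : Fin n → Machine M}
    (hcap : ∀ m t, load (placement job A) m t ≤ g m.1) (t : ℝ) :
    ∑ i, (if (job i).Active t then (job i).size * (r (A i).1 / g (A i).1) else 0) ≤
      rateAt r (placement job A) t := by
  have h1 : ∑ i, (if (job i).Active t then (job i).size * (r (A i).1 / g (A i).1) else 0) =
      ∑ m ∈ ((placement job A).map Prod.snd).toFinset,
        load (placement job A) m t * (r m.1 / g m.1) := by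
    simp only [load_placement, Finset.sum_mul]
    rw [Finset.sum_comm]
    refine Finset.sum_congr rfl fun i _ => ?_
    rw [Finset.sum_eq_single_of_mem (A i) (machine_mem_placement job A i)]
    · by_cases h : (job i).Active t <;> simp [h]
    · intro m _ hm
      rw [if_neg (fun h => hm h.1.symm), zero_mul]
  rw [h1]
  unfold rateAt
  refine Finset.sum_le_sum fun m _ => ?_
  split_ifs with hm
  · have h2 := mul_le_mul_of_nonneg_right (hcap m t) (div_pos (hr m.1) (hg m.1)).le
    rwa [mul_div_cancel₀ _ (hg m.1).ne'] at h2
  · have : load (placement job A) m t = 0 := by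
      rw [load_placement]
      refine Finset.sum_eq_zero fun i _ => if_neg fun h => ?_
      exact hm (mem_busySet_placement.mpr ⟨i, h⟩)
    rw [this, zero_mul]

/-- If the least value is at least `G / 2`, all are. Otherwise every other value exceeds `G` minus
the least one, and the surplus is a product of the nonnegative factors `K.card - 2` and `G / 2 - v
k₀`, up to a factor of two. -/
theorem card_mul_le_of_pairwise {K : Finset ℕ} {v : ℕ → ℝ} {G : ℝ} (hK : 2 ≤ K.card)
    (h : ∀ k ∈ K, ∀ k' ∈ K, k < k' → G < v k + v k') : K.card * G ≤ 2 * ∑ k ∈ K, v k := by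
  obtain ⟨k₀, hk₀, hmin⟩ := K.exists_min_image v (Finset.card_pos.mp (by omega))
  have hpair : ∀ k ∈ K, k ≠ k₀ → G < v k + v k₀ := by
    intro k hk hne
    rcases lt_or_gt_of_ne hne with hlt | hlt
    · exact h k hk k₀ hk₀ hlt
    · rw [add_comm]
      exact h k₀ hk₀ k hk hlt
  have hcard : (2 : ℝ) ≤ K.card := by exact_mod_cast hK
  rcases le_or_gt (G / 2) (v k₀) with hv | hv
  · have := Finset.card_nsmul_le_sum K v (G / 2) fun k hk => hv.trans (hmin k hk)
    rw [nsmul_eq_mul] at this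
    linarith
  · have h1 := Finset.card_nsmul_le_sum (K.erase k₀) v (G - v k₀) fun k hk => by
      have := hpair k (Finset.mem_of_mem_erase hk) (Finset.ne_of_mem_erase hk)
      linarith
    rw [nsmul_eq_mul, Finset.card_erase_of_mem hk₀, Nat.cast_sub (by omega)] at h1
    rw [← Finset.add_sum_erase _ _ hk₀]
    push_cast at h1
    nlinarith [mul_nonneg (sub_nonneg.mpr hcard) (sub_nonneg.mpr hv.le)]

end IndexedPlacements

/-! ### Roots of the forest cut off at `j` -/

section ParentLE

variable {M : ℕ} {g r : Fin M → ℝ}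

/-- The types whose parent is at most `j`. -/
def ParentLE (g r : Fin M → ℝ) (j x : Fin M) : Prop := ∃ p, parent g r x = some p ∧ p ≤ j

/-- Take the highest ancestor that is at most `j`. -/
theorem ParentLE.exists_root {j x : Fin M} (h : ParentLE g r j x) :
    ∃ y, (y ≤ j ∧ ¬ ParentLE g r j y) ∧ StrictAnc g r y x := by
  classical
  obtain ⟨p, hp, hpj⟩ := h
  have hne : (Finset.univ.filter (fun y => y ≤ j ∧ StrictAnc g r y x)).Nonempty :=
    ⟨p, Finset.mem_filter.mpr ⟨Finset.mem_univ _, hpj, Relation.TransGen.single hp⟩⟩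
  obtain ⟨y, hy, hmax⟩ := Finset.exists_max_image _ id hne
  obtain ⟨hyj, hyx⟩ := (Finset.mem_filter.mp hy).2
  refine ⟨y, ⟨hyj, ?_⟩, hyx⟩
  rintro ⟨q, hq, hqj⟩
  have := hmax q (Finset.mem_filter.mpr ⟨Finset.mem_univ _, hqj, Relation.TransGen.tail hyx hq⟩)
  exact absurd (lt_of_parent_eq_some hq) (not_lt.mpr this)

end ParentLE

/-! ### Comparison of rates at a single time -/

section Pointwise

variable {M n : ℕ} [NeZero M] {g r : Fin M → ℝ} {job : Fin n → Job} {A B : Fin n → Machine M}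

/-- The standing assumptions for comparing the placement `A` of the algorithm with a placement `B`
that respects the capacities. -/
structure Comparison (g r : Fin M → ℝ) (job : Fin n → Job) (A B : Fin n → Machine M) : Prop where
  g_pos : ∀ z, 0 < g z
  g_mono : StrictMono g
  r_pow : ∀ z, ∃ k : ℤ, r z = (8 : ℝ) ^ k
  r_mono : Monotone r
  inv : Invariant g r (List.ofFn job) (placement job A)
  cap : ∀ m t, load (placement job B) m t ≤ g m.1
  size_pos : ∀ i, 0 < (job i).size
  start_lt : ∀ i, (job i).start < (job i).finish

/-- Every job active at some time in `(τ - 2ℓ, τ]`, where `ℓ` bounds the lengths of the jobs, is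
active at one of the sample times `θ k` with `k ∈ T`. -/
structure Sampled (job : Fin n → Job) (τ ℓ : ℝ) (T : Finset ℕ) (θ : ℕ → ℝ) : Prop where
  len_le : ∀ i, (job i).len ≤ ℓ
  covers : ∀ i s, τ - 2 * ℓ < s → s ≤ τ → (job i).Active s → ∃ k ∈ T, (job i).Active (θ k)

open Classical in
/-- The jobs active at one of the sample times. -/
noncomputable def sampledJobs (job : Fin n → Job) (T : Finset ℕ) (θ : ℕ → ℝ) : Finset (Fin n) :=
  Finset.univ.filter fun i => ∃ k ∈ T, (job i).Active (θ k)

/-- The total rate, over the sample times, of the busy machines of the placement `B`. -/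
noncomputable def sampledRate (r : Fin M → ℝ) (job : Fin n → Job) (B : Fin n → Machine M)
    (T : Finset ℕ) (θ : ℕ → ℝ) : ℝ :=
  ∑ k ∈ T, rateAt r (placement job B) (θ k)

open Classical in
/-- The total size of the sampled jobs which `A` places on machines of type `x`. -/
noncomputable def sampledVolume (job : Fin n → Job) (A : Fin n → Machine M) (T : Finset ℕ)
    (θ : ℕ → ℝ) (x : Fin M) : ℝ :=
  ∑ i ∈ sampledJobs job T θ, if (A i).1 = x then (job i).size else 0

variable {τ ℓ : ℝ} {T : Finset ℕ} {θ : ℕ → ℝ}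

theorem mem_sampledJobs {i : Fin n} :
    i ∈ sampledJobs job T θ ↔ ∃ k ∈ T, (job i).Active (θ k) := by
  classical
  unfold sampledJobs
  simp

theorem Sampled.mem (hs : Sampled job τ ℓ T θ) {i : Fin n} {s : ℝ} (h1 : τ - 2 * ℓ < s)
    (h2 : s ≤ τ) (h : (job i).Active s) : i ∈ sampledJobs job T θ :=
  mem_sampledJobs.mpr (hs.covers i s h1 h2 h)

namespace Comparison

theorem r_pos (hc : Comparison g r job A B) (z : Fin M) : 0 < r z := by
  obtain ⟨k, hk⟩ := hc.r_pow z
  rw [hk]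
  positivity

theorem ratio_pos (hc : Comparison g r job A B) (z : Fin M) : 0 < r z / g z :=
  div_pos (hc.r_pos z) (hc.g_pos z)

theorem sampledRate_nonneg (hc : Comparison g r job A B) : 0 ≤ sampledRate r job B T θ :=
  Finset.sum_nonneg fun _ _ => rateAt_nonneg hc.r_pos _ _

theorem rate_le_sampledRate (hc : Comparison g r job A B) {i : Fin n}
    (hi : i ∈ sampledJobs job T θ) : r (B i).1 ≤ sampledRate r job B T θ := by
  obtain ⟨k, hk, hik⟩ := mem_sampledJobs.mp hi
  exact (rate_le_rateAt hc.r_pos hik).trans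
    (Finset.single_le_sum (f := fun k => rateAt r (placement job B) (θ k))
      (fun _ _ => rateAt_nonneg hc.r_pos _ _) hk)

/-- Each sampled job is counted at one sample time at least; counting it more often only helps. -/
theorem sum_size_mul_le_sampledRate (hc : Comparison g r job A B) :
    ∑ i ∈ sampledJobs job T θ, (job i).size * (r (B i).1 / g (B i).1) ≤
      sampledRate r job B T θ := by
  classical
  have hnn : ∀ i, 0 ≤ (job i).size * (r (B i).1 / g (B i).1) := fun i =>
    mul_nonneg (hc.size_pos i).le (hc.ratio_pos _).le
  calc ∑ i ∈ sampledJobs job T θ, (job i).size * (r (B i).1 / g (B i).1)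
      ≤ ∑ i ∈ sampledJobs job T θ, ∑ k ∈ T,
          if (job i).Active (θ k) then (job i).size * (r (B i).1 / g (B i).1) else 0 := by
        refine Finset.sum_le_sum fun i hi => ?_
        obtain ⟨k, hk, hik⟩ := mem_sampledJobs.mp hi
        refine (if_pos hik).ge.trans (Finset.single_le_sum (f := fun k =>
          if (job i).Active (θ k) then (job i).size * (r (B i).1 / g (B i).1) else 0)
          (fun k _ => ?_) hk)
        split_ifs
        · exact hnn i
        · exact le_rfl
    _ ≤ ∑ i, ∑ k ∈ T,
          if (job i).Active (θ k) then (job i).size * (r (B i).1 / g (B i).1) else 0 := by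
        refine Finset.sum_le_sum_of_subset_of_nonneg (Finset.subset_univ _) fun i _ _ => ?_
        refine Finset.sum_nonneg fun k _ => ?_
        split_ifs
        · exact hnn i
        · exact le_rfl
    _ = ∑ k ∈ T, ∑ i,
          if (job i).Active (θ k) then (job i).size * (r (B i).1 / g (B i).1) else 0 :=
        Finset.sum_comm
    _ ≤ sampledRate r job B T θ :=
        Finset.sum_le_sum fun k _ => sum_size_mul_le_rateAt hc.g_pos hc.r_pos hc.cap _

theorem exactType_le (hc : Comparison g r job A B) (i : Fin n) :
    exactType g (job i).size ≤ (B i).1 := by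
  classical
  refine BSHM.exactType_le (le_trans ?_ (hc.cap (B i) (job i).start))
  rw [load_placement]
  have hact : (job i).Active (job i).start := ⟨le_rfl, hc.start_lt i⟩
  have h1 : (if B i = B i ∧ (job i).Active (job i).start then (job i).size else 0) =
    (job i).size := if_pos ⟨rfl, hact⟩
  refine h1.ge.trans (Finset.single_le_sum (f := fun i' =>
    if B i' = B i ∧ (job i').Active (job i).start then (job i').size else 0) (fun i' _ => ?_)
    (Finset.mem_univ i))
  split_ifs
  · exact (hc.size_pos i').le
  · exact le_rfl

theorem path (hc : Comparison g r job A B) (i : Fin n) :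
    (A i).1 = exactType g (job i).size ∨ StrictAnc g r (A i).1 (exactType g (job i).size) :=
  hc.inv.path (job i, A i) (mem_placement.mpr ⟨i, rfl⟩)

theorem start_gt (hs : Sampled job τ ℓ T θ) {i : Fin n} {t : ℝ}
    (hi : (job i).Active t) : t - ℓ < (job i).start := by
  have h1 := hs.len_le i
  have h2 := hi.2
  unfold Job.len at h1
  linarith

/-- First fit: if at least two type-`x` machines are open, then the recent jobs on the machines of
this type fill at least half of them. -/
theorem card_mul_le_sampledVolume (hc : Comparison g r job A B) (hs : Sampled job τ ℓ T θ) {t : ℝ}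
    (ht : τ - ℓ < t) (ht' : t ≤ τ) {x : Fin M}
    (h2 : 2 ≤ (openSerials (placement job A) x t).card) :
    (openSerials (placement job A) x t).card * r x ≤
      2 * (sampledVolume job A T θ x * (r x / g x)) := by
  classical
  set K := openSerials (placement job A) x t with hK
  let v : ℕ → ℝ := fun k =>
    ∑ i ∈ sampledJobs job T θ, if A i = (x, k) then (job i).size else 0
  have hℓ : 0 ≤ ℓ := by linarith
  -- A job on the later machine `k'` did not fit on `k` at its start. That start lies after `τ - 2 *
  -- ℓ`, so all jobs then on `k` are sampled.
  have hpair : ∀ k ∈ K, ∀ k' ∈ K, k < k' → g x < v k + v k' := by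
    intro k hk k' hk' hlt
    obtain ⟨i, hi, hit⟩ := mem_openSerials_placement.mp hk'
    have hst := start_gt hs hit
    have hff := hc.inv.firstFit (job i, A i) (mem_placement.mpr ⟨i, rfl⟩) t hit k
      (by simpa [hi] using hk) (by simpa [hi] using hlt)
    simp only [hi] at hff
    have h1 : load (placement job A) (x, k) (job i).start ≤ v k := by
      simp only [load_placement, v, ← Finset.sum_filter]
      refine Finset.sum_le_sum_of_subset_of_nonneg (fun i' hi' => ?_)
        fun i' _ _ => (hc.size_pos i').le
      obtain ⟨h3, h4⟩ := (Finset.mem_filter.mp hi').2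
      exact Finset.mem_filter.mpr ⟨hs.mem (by linarith) (hit.1.trans ht') h4, h3⟩
    have h3 : (job i).size ≤ v k' := by
      have h4 : (if A i = (x, k') then (job i).size else 0) = (job i).size := if_pos hi
      refine h4.ge.trans (Finset.single_le_sum (f := fun i' =>
        if A i' = (x, k') then (job i').size else 0) (fun i' _ => ?_)
        (hs.mem (by linarith) ht' hit))
      split_ifs
      · exact (hc.size_pos i').le
      · exact le_rfl
    linarith
  have hsum : ∑ k ∈ K, v k ≤ sampledVolume job A T θ x := by
    unfold sampledVolume
    rw [Finset.sum_comm]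
    refine Finset.sum_le_sum fun i _ => ?_
    by_cases hx : (A i).1 = x
    · rw [if_pos hx]
      have : ∀ k, (if A i = (x, k) then (job i).size else 0) =
          if (A i).2 = k then (job i).size else 0 := fun k => by
        congr 1
        rw [Prod.ext_iff]
        simp [hx]
      simp only [this, Finset.sum_ite_eq]
      split_ifs
      · exact le_rfl
      · exact (hc.size_pos i).le
    · rw [if_neg hx]
      refine (Finset.sum_eq_zero fun k _ => if_neg fun h => hx ?_).le
      rw [h]
  have h3 := (card_mul_le_of_pairwise h2 hpair).trans (mul_le_mul_of_nonneg_left hsum zero_le_two)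
  have h4 := mul_le_mul_of_nonneg_right h3 (hc.ratio_pos x).le
  have h5 : (K.card : ℝ) * g x * (r x / g x) = K.card * r x := by
    rw [mul_assoc, mul_div_cancel₀ _ (hc.g_pos x).ne']
  linarith

/-- The types without a parent up to `j` could not be replaced by better ones below `j`. -/
theorem sum_sampledVolume_le (hc : Comparison g r job A B) {j : Fin M}
    (hj : ∀ i ∈ sampledJobs job T θ, (B i).1 ≤ j) (X : Finset (Fin M))
    (hX : ∀ x ∈ X, ¬ ParentLE g r j x) :
    ∑ x ∈ X, sampledVolume job A T θ x * (r x / g x) ≤ sampledRate r job B T θ := by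
  classical
  refine le_trans ?_ hc.sum_size_mul_le_sampledRate
  unfold sampledVolume
  simp only [Finset.sum_mul]
  rw [Finset.sum_comm]
  refine Finset.sum_le_sum fun i hi => ?_
  have hnn : 0 ≤ (job i).size * (r (B i).1 / g (B i).1) :=
    mul_nonneg (hc.size_pos i).le (hc.ratio_pos _).le
  simp only [ite_mul, zero_mul, Finset.sum_ite_eq]
  split_ifs with hx
  · refine mul_le_mul_of_nonneg_left ?_ (hc.size_pos i).le
    have hno := hX _ hx
    have hBj := hj i hi
    -- If `A` went above the type of `B`, the path from the exact type passed over the latter, so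
    -- `A` is more cost-effective. Otherwise a better type in `B` would give `A`'s type a parent at
    -- most `j`.
    rcases lt_or_ge (B i).1 (A i).1 with hlt | hge
    · rcases hc.path i with h | h
      · exact absurd (hc.exactType_le i) (by rw [← h]; exact not_le.mpr hlt)
      · exact ((strictAnc_iff.mp h).2 _ (hc.exactType_le i) hlt).le
    · rcases hge.eq_or_lt with h | h
      · rw [h]
      · by_contra! hlt
        obtain ⟨p, hp, hp'⟩ := exists_parent h hlt
        exact hno ⟨p, hp, hp'.trans hBj⟩
  · exact hnn

/-- Two roots whose rates do not increase would give the lower one a parent at most `j`, so root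
rates increase strictly and sum geometrically. -/
theorem sum_root_le (hc : Comparison g r job A B) {j : Fin M} (Y : Finset (Fin M))
    (hY : ∀ y ∈ Y, y ≤ j ∧ ¬ ParentLE g r j y) : ∑ y ∈ Y, r y ≤ 8 / 7 * r j := by
  refine sum_rate_le hc.r_pow Y _ (hc.r_pos j).le (fun x hx y hy hxy => ?_)
    fun y hy => hc.r_mono (hY y hy).1
  by_contra! hle
  obtain ⟨p, hp, hp'⟩ := exists_parent_of_eq hc.g_pos hc.g_mono hc.r_pos hxy hle
  exact (hY x hx).2 ⟨p, hp, hp'.trans (hY y hy).1⟩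

/-- Charge each type to a root above it: the subtree of a root costs less than the root's rate, and
the root rates are summable. -/
theorem sum_parentLE_le (hc : Comparison g r job A B) {j : Fin M} (t : ℝ) (Q : Finset (Fin M))
    (hQ : ∀ x ∈ Q, ParentLE g r j x) :
    ∑ x ∈ Q, ((openSerials (placement job A) x t).card : ℝ) * r x ≤ 8 / 7 * r j := by
  classical
  let Y : Finset (Fin M) := Finset.univ.filter fun y => y ≤ j ∧ ¬ ParentLE g r j y
  let w : Fin M → ℝ := fun x => ((openSerials (placement job A) x t).card : ℝ) * r x
  have hw : ∀ x, 0 ≤ w x := fun x => mul_nonneg (Nat.cast_nonneg _) (hc.r_pos x).le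
  have hite : ∀ x y, 0 ≤ if StrictAnc g r y x then w x else 0 := fun x y => by
    split_ifs
    · exact hw x
    · exact le_rfl
  calc ∑ x ∈ Q, w x ≤ ∑ x ∈ Q, ∑ y ∈ Y, if StrictAnc g r y x then w x else 0 := by
        refine Finset.sum_le_sum fun x hx => ?_
        obtain ⟨y, hy, hyx⟩ := (hQ x hx).exists_root
        exact (if_pos hyx).ge.trans (Finset.single_le_sum
          (f := fun y => if StrictAnc g r y x then w x else 0) (fun y _ => hite x y)
          (Finset.mem_filter.mpr ⟨Finset.mem_univ _, hy⟩))
    _ ≤ ∑ x, ∑ y ∈ Y, if StrictAnc g r y x then w x else 0 :=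
        Finset.sum_le_sum_of_subset_of_nonneg (Finset.subset_univ _) fun x _ _ =>
          Finset.sum_nonneg fun y _ => hite x y
    _ = ∑ y ∈ Y, subtreeRate g r (placement job A) t y := by
        rw [Finset.sum_comm]
        refine Finset.sum_congr rfl fun y _ => ?_
        unfold subtreeRate
        rw [← Finset.sum_filter]
    _ ≤ ∑ y ∈ Y, r y := Finset.sum_le_sum fun y _ => (hc.inv.subtreeRate_lt y t).le
    _ ≤ 8 / 7 * r j := hc.sum_root_le Y fun y hy => (Finset.mem_filter.mp hy).2

open Classical in
/-- The open machines, except for one machine of each type above `j`, are paid for by the sampled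
machines of `B`. -/
theorem sum_open_le (hc : Comparison g r job A B) (hs : Sampled job τ ℓ T θ) {t : ℝ}
    (ht : τ - ℓ < t) (ht' : t ≤ τ) {j : Fin M} (hj : ∀ i ∈ sampledJobs job T θ, (B i).1 ≤ j)
    (hjr : r j ≤ sampledRate r job B T θ) (Q : Finset (Fin M)) :
    ∑ x ∈ Q, ((openSerials (placement job A) x t).card : ℝ) * r x ≤
      30 / 7 * sampledRate r job B T θ +
        ∑ x ∈ Q.filter (fun x => j < x ∧ (openSerials (placement job A) x t).Nonempty), r x := by
  let w : Fin M → ℝ := fun x => ((openSerials (placement job A) x t).card : ℝ) * r x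
  let V : Fin M → ℝ := fun x => sampledVolume job A T θ x * (r x / g x)
  have hV : ∀ x, 0 ≤ V x := fun x => by
    refine mul_nonneg (Finset.sum_nonneg fun i _ => ?_) (hc.ratio_pos x).le
    split_ifs
    · exact (hc.size_pos i).le
    · exact le_rfl
  -- The four charges are: types below a root, a single machine of a root type, two or more machines
  -- (first fit), and a single machine above `j`. The first three total `8/7 + 8/7 + 2 = 30/7`.
  have hterm : ∀ x ∈ Q, w x ≤ (if ParentLE g r j x then w x else 0) +
      (if x ≤ j ∧ ¬ ParentLE g r j x then r x else 0) +
      (if ¬ ParentLE g r j x then 2 * V x else 0) +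
      (if j < x ∧ (openSerials (placement job A) x t).Nonempty then r x else 0) := by
    intro x _
    have hrx := hc.r_pos x
    have hVx := hV x
    by_cases hP : ParentLE g r j x
    · rw [if_pos hP, if_neg (fun h => h.2 hP), if_neg (fun h => h hP)]
      split_ifs <;> linarith
    · rw [if_neg hP, if_pos hP]
      rcases Nat.lt_or_ge (openSerials (placement job A) x t).card 2 with h | h
      · rcases Finset.eq_empty_or_nonempty (openSerials (placement job A) x t) with he | he
        · have : w x = 0 := by simp [w, he]
          rw [this]
          split_ifs <;> linarith
        · have h1 : (openSerials (placement job A) x t).card = 1 := by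
            have := Finset.card_pos.mpr he
            omega
          have : w x = r x := by simp [w, h1]
          rw [this]
          rcases le_or_gt x j with hxj | hxj
          · rw [if_pos ⟨hxj, hP⟩]
            split_ifs <;> linarith
          · rw [if_pos (⟨hxj, he⟩ : j < x ∧ _)]
            split_ifs <;> linarith
      · have : w x ≤ 2 * V x := hc.card_mul_le_sampledVolume hs ht ht' h
        split_ifs <;> linarith
  refine (Finset.sum_le_sum hterm).trans ?_
  rw [Finset.sum_add_distrib, Finset.sum_add_distrib, Finset.sum_add_distrib,
    ← Finset.sum_filter, ← Finset.sum_filter, ← Finset.sum_filter, ← Finset.sum_filter,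
    ← Finset.mul_sum]
  have h1 : ∑ x ∈ Q.filter (fun x => ParentLE g r j x), w x ≤ 8 / 7 * r j :=
    hc.sum_parentLE_le t _ fun x hx => (Finset.mem_filter.mp hx).2
  have h2 : ∑ x ∈ Q.filter (fun x => x ≤ j ∧ ¬ ParentLE g r j x), r x ≤ 8 / 7 * r j :=
    hc.sum_root_le _ fun x hx => (Finset.mem_filter.mp hx).2
  have h3 : ∑ x ∈ Q.filter (fun x => ¬ ParentLE g r j x), V x ≤ sampledRate r job B T θ :=
    hc.sum_sampledVolume_le hj _ fun x hx => (Finset.mem_filter.mp hx).2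
  linarith

/-- A single open machine already contributes its rate to the subtree of `a`. -/
theorem rate_lt_of_strictAnc (hc : Comparison g r job A B) {a x : Fin M} {t : ℝ}
    (ha : StrictAnc g r a x) (hx : (openSerials (placement job A) x t).Nonempty) : r x < r a := by
  classical
  refine lt_of_le_of_lt ?_ (hc.inv.subtreeRate_lt a t)
  have h1 : (1 : ℝ) ≤ (openSerials (placement job A) x t).card := by
    exact_mod_cast Finset.card_pos.mpr hx
  have h2 := mul_le_mul_of_nonneg_right h1 (hc.r_pos x).le
  rw [one_mul] at h2
  unfold subtreeRate
  exact h2.trans (Finset.single_le_sum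
    (f := fun x => ((openSerials (placement job A) x t).card : ℝ) * r x)
    (fun y _ => mul_nonneg (Nat.cast_nonneg _) (hc.r_pos y).le)
    (Finset.mem_filter.mpr ⟨Finset.mem_univ _, ha⟩))

/-- The open types above `j` form a chain of strictly increasing rates. -/
theorem rate_lt_of_open (hc : Comparison g r job A B) (hs : Sampled job τ ℓ T θ) {t : ℝ}
    (ht : τ - ℓ < t) (ht' : t ≤ τ) {j : Fin M} (hj : ∀ i ∈ sampledJobs job T θ, (B i).1 ≤ j)
    {x y : Fin M} (hjx : j < x) (hxy : x < y)
    (hx : (openSerials (placement job A) x t).Nonempty)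
    (hy : (openSerials (placement job A) y t).Nonempty) : r x < r y := by
  obtain ⟨k, hk⟩ := hy
  obtain ⟨i, hi, hit⟩ := mem_openSerials_placement.mp hk
  have hst := start_gt hs hit
  have hlen := hc.start_lt i
  have hle := hs.len_le i
  unfold Job.len at hle
  have hm : exactType g (job i).size ≤ j :=
    (hc.exactType_le i).trans (hj i (hs.mem (by linarith) ht' hit))
  refine hc.rate_lt_of_strictAnc ?_ hx
  have hp := hc.path i
  rw [hi] at hp
  rcases hp with hp | hp
  · exact absurd (hp.le.trans hm) (not_le.mpr (hjx.trans hxy))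
  · exact strictAnc_iff.mpr ⟨hxy, fun z hz => (strictAnc_iff.mp hp).2 z (hm.trans (hjx.le.trans hz))⟩

/-- A job reaching `x` was refused at every type it passed. The refusal at the last type cheaper
than `x` exhibits a subtree whose open rate was comparable to `r x`, and `sum_open_le` at the job's
start bounds that rate. -/
theorem rate_le_of_open (hc : Comparison g r job A B) (hs : Sampled job τ ℓ T θ)
    {j : Fin M} (hj : ∀ i ∈ sampledJobs job T θ, (B i).1 ≤ j)
    (hjr : r j ≤ sampledRate r job B T θ) {x : Fin M} (hjx : j < x)
    (hx : (openSerials (placement job A) x τ).Nonempty) :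
    r x ≤ 6 * sampledRate r job B T θ := by
  classical
  have hB := (hc.r_pos j).trans_le hjr
  obtain ⟨k, hk⟩ := hx
  obtain ⟨i, hi, hit⟩ := mem_openSerials_placement.mp hk
  have hst := start_gt hs hit
  have hlen := hc.start_lt i
  have hle := hs.len_le i
  unfold Job.len at hle
  have hm : exactType g (job i).size ≤ j :=
    (hc.exactType_le i).trans (hj i (hs.mem (by linarith) le_rfl hit))
  have hp := hc.path i
  have hden := hc.inv.denied (job i, A i) (mem_placement.mpr ⟨i, rfl⟩)
  simp only [hi] at hp hden
  generalize exactType g (job i).size = m at hm hp hden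
  have hxm : StrictAnc g r x m := by
    rcases hp with hp | hp
    · exact absurd (hp.le.trans hm) (not_le.mpr hjx)
    · exact hp
  rcases le_or_gt (r x) (r m) with hxm' | hxm'
  · have := hc.r_mono hm
    linarith
  · have hne : (Finset.univ.filter (fun z => (z = m ∨ StrictAnc g r z m) ∧ StrictAnc g r x z ∧
        r z < r x)).Nonempty :=
      ⟨m, Finset.mem_filter.mpr ⟨Finset.mem_univ _, Or.inl rfl, hxm, hxm'⟩⟩
    -- Maximality of `z` forces the ancestor `a` responsible for its refusal to have rate at least
    -- `r x`, hence `r z ≤ r a / 8`.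
    obtain ⟨z, hz, hmax⟩ := Finset.exists_max_image _ id hne
    obtain ⟨hzm, hxz, hrz⟩ := (Finset.mem_filter.mp hz).2
    obtain ⟨a, haz, ha⟩ := hden z hzm hxz
    have hza := (strictAnc_iff.mp haz).1
    have hxa : r x ≤ r a := by
      rcases le_or_gt x a with h | h
      · exact hc.r_mono h
      · by_contra! hlt
        have h1 : StrictAnc g r x a :=
          strictAnc_iff.mpr ⟨h, fun y hy => (strictAnc_iff.mp hxz).2 y (hza.le.trans hy)⟩
        have h2 : StrictAnc g r a m := by
          rcases hzm with rfl | hzm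
          · exact haz
          · exact Relation.TransGen.trans hzm haz
        exact absurd hza (not_lt.mpr (hmax a
          (Finset.mem_filter.mpr ⟨Finset.mem_univ _, Or.inr h2, h1, hlt⟩)))
    have hrz' := rate_le_div hc.r_pow (hrz.trans_le hxa)
    have h1 := hc.sum_open_le hs hst hit.1 hj hjr
      (Finset.univ.filter (fun y => StrictAnc g r a y))
    have h2 : ∑ y ∈ (Finset.univ.filter (fun y => StrictAnc g r a y)).filter (fun y => j < y ∧
        (openSerials (placement job A) y (job i).start).Nonempty), r y ≤ 8 / 7 * (r a / 8) := by
      refine sum_rate_le hc.r_pow _ _ (by linarith [hc.r_pos a]) (fun y hy y' hy' hlt => ?_)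
        fun y hy => ?_
      · exact hc.rate_lt_of_open hs hst hit.1 hj (Finset.mem_filter.mp hy).2.1 hlt
          (Finset.mem_filter.mp hy).2.2 (Finset.mem_filter.mp hy').2.2
      · obtain ⟨h3, _, h4⟩ := Finset.mem_filter.mp hy
        exact rate_le_div hc.r_pow
          (hc.rate_lt_of_strictAnc (Finset.mem_filter.mp h3).2 h4)
    -- With `R` the sampled rate, `7/8 * r a ≤ 30/7 * R + 1/7 * r a`, so `r x ≤ r a ≤ 240/41 * R < 6
    -- * R`.
    unfold subtreeRate at ha
    linarith

/-- At every time the total rate of the open machines is at most twelve times the sampled rate of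
any placement that respects the capacities. -/
theorem sum_open_le_sampledRate (hc : Comparison g r job A B) (hs : Sampled job τ ℓ T θ) :
    ∑ x, ((openSerials (placement job A) x τ).card : ℝ) * r x ≤
      12 * sampledRate r job B T θ := by
  classical
  have hB : 0 ≤ sampledRate r job B T θ := hc.sampledRate_nonneg
  by_cases hempty : ∀ x, openSerials (placement job A) x τ = ∅
  · simp only [hempty, Finset.card_empty, Nat.cast_zero, zero_mul, Finset.sum_const_zero]
    linarith
  · push Not at hempty
    obtain ⟨x, k, hk⟩ := hempty
    obtain ⟨i, hi, hit⟩ := mem_openSerials_placement.mp hk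
    have hst := start_gt hs hit
    have hlen := hc.start_lt i
    have hle := hs.len_le i
    unfold Job.len at hle
    obtain ⟨i', hi', hmax⟩ := Finset.exists_max_image (sampledJobs job T θ) (fun i => (B i).1)
      ⟨i, hs.mem (by linarith) le_rfl hit⟩
    have hjr := hc.rate_le_sampledRate hi'
    have hτ : τ - ℓ < τ := by linarith
    have h1 := hc.sum_open_le hs hτ le_rfl hmax hjr Finset.univ
    have h2 : ∑ y ∈ Finset.univ.filter (fun y => (B i').1 < y ∧
        (openSerials (placement job A) y τ).Nonempty), r y ≤
        8 / 7 * (6 * sampledRate r job B T θ) := by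
      refine sum_rate_le hc.r_pow _ _ (by linarith) (fun y hy y' hy' hlt => ?_) fun y hy => ?_
      · exact hc.rate_lt_of_open hs hτ le_rfl hmax (Finset.mem_filter.mp hy).2.1 hlt
          (Finset.mem_filter.mp hy).2.2 (Finset.mem_filter.mp hy').2.2
      · exact hc.rate_le_of_open hs hmax hjr (Finset.mem_filter.mp hy).2.1
          (Finset.mem_filter.mp hy).2.2
    -- The total is `30/7 + 48/7 = 78/7`, below `12`.
    linarith

end Comparison

end Pointwise

/-! ### Cost as an integral of the rate -/

section Cost

variable {M : ℕ}

theorem busySet_eq_biUnion (S : Placement M) (m : Machine M) :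
    busySet S m = ⋃ p ∈ {p | p ∈ S ∧ p.2 = m}, Set.Ico p.1.start p.1.finish := by
  ext t
  simp only [busySet, Job.Active, Set.mem_ofPred_eq, Set.mem_iUnion, Set.mem_Ico, exists_prop,
    and_assoc]

theorem finite_setOf_mem_and (S : Placement M) (m : Machine M) :
    {p | p ∈ S ∧ p.2 = m}.Finite :=
  S.finite_toSet.subset fun _ h => h.1

theorem measurableSet_busySet (S : Placement M) (m : Machine M) :
    MeasurableSet (busySet S m) := by
  rw [busySet_eq_biUnion]
  exact (finite_setOf_mem_and S m).measurableSet_biUnion fun _ _ => measurableSet_Ico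

theorem volume_busySet_lt_top (S : Placement M) (m : Machine M) :
    MeasureTheory.volume (busySet S m) < ⊤ := by
  rw [busySet_eq_biUnion]
  exact MeasureTheory.measure_biUnion_lt_top (finite_setOf_mem_and S m) fun p _ => by
    simp [Real.volume_Ico]

theorem rateAt_eq_sum_indicator (r : Fin M → ℝ) (S : Placement M) :
    rateAt r S = fun t => ∑ m ∈ (S.map Prod.snd).toFinset,
      (busySet S m).indicator (fun _ => r m.1) t := by
  classical
  funext t
  unfold rateAt
  refine Finset.sum_congr rfl fun m _ => ?_
  rw [Set.indicator_apply]

theorem integrable_indicator_busySet (r : Fin M → ℝ) (S : Placement M) (m : Machine M) :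
    MeasureTheory.Integrable ((busySet S m).indicator (fun _ => r m.1)) :=
  (MeasureTheory.integrable_indicator_iff (measurableSet_busySet S m)).mpr
    (MeasureTheory.integrableOn_const (volume_busySet_lt_top S m).ne)

theorem integrable_rateAt (r : Fin M → ℝ) (S : Placement M) :
    MeasureTheory.Integrable (rateAt r S) := by
  rw [rateAt_eq_sum_indicator]
  exact MeasureTheory.integrable_finsetSum _ fun m _ => integrable_indicator_busySet r S m

theorem integral_rateAt (r : Fin M → ℝ) (S : Placement M) :
    ∫ t, rateAt r S t = cost r S := by
  rw [rateAt_eq_sum_indicator,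
    MeasureTheory.integral_finsetSum _ fun m _ => integrable_indicator_busySet r S m]
  unfold cost
  refine Finset.sum_congr rfl fun m _ => ?_
  rw [MeasureTheory.integral_indicator (measurableSet_busySet S m),
    MeasureTheory.setIntegral_const, smul_eq_mul, mul_comm]
  rfl

theorem cost_mono {c r : Fin M → ℝ} (h : ∀ z, c z ≤ r z) (S : Placement M) :
    cost c S ≤ cost r S :=
  Finset.sum_le_sum fun m _ => mul_le_mul_of_nonneg_right (h m.1) ENNReal.toReal_nonneg

theorem cost_nonneg {c : Fin M → ℝ} (h : ∀ z, 0 < c z) (S : Placement M) : 0 ≤ cost c S :=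
  Finset.sum_nonneg fun m _ => mul_nonneg (h m.1).le ENNReal.toReal_nonneg

theorem cost_const_mul (a : ℝ) (c : Fin M → ℝ) (S : Placement M) :
    cost (fun z => a * c z) S = a * cost c S := by
  unfold cost
  rw [Finset.mul_sum]
  exact Finset.sum_congr rfl fun m _ => mul_assoc _ _ _

theorem rateAt_le_sum_card {r : Fin M → ℝ} (hr : ∀ z, 0 < r z) (S : Placement M) (t : ℝ) :
    rateAt r S t ≤ ∑ x, ((openSerials S x t).card : ℝ) * r x := by
  classical
  unfold rateAt
  rw [← Finset.sum_filter]
  have h1 : ∑ x, ((openSerials S x t).card : ℝ) * r x =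
      ∑ m ∈ Finset.univ.sigma (fun x => openSerials S x t), r m.1 := by
    rw [Finset.sum_sigma]
    refine Finset.sum_congr rfl fun x _ => ?_
    simp
  rw [h1]
  have hinj : Set.InjOn (fun m : Machine M => (⟨m.1, m.2⟩ : (_ : Fin M) × ℕ))
      ((S.map Prod.snd).toFinset.filter fun m => t ∈ busySet S m) := fun m _ m' _ h => by
    simp only [Sigma.mk.injEq, heq_eq_eq] at h
    exact Prod.ext h.1 h.2
  refine (Finset.sum_image (f := fun m => r m.1) hinj).ge.trans
    (Finset.sum_le_sum_of_subset_of_nonneg (fun m hm => ?_) fun m _ _ => (hr m.1).le)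
  obtain ⟨m', hm', rfl⟩ := Finset.mem_image.mp hm
  exact Finset.mem_sigma.mpr
    ⟨Finset.mem_univ _, mem_openSerials.mpr (Finset.mem_filter.mp hm').2⟩

theorem exists_eq_placement {S : Placement M} {L : List Job} (h : S.map Prod.fst = L) :
    ∃ A : Fin L.length → Machine M, S = placement L.get A := by
  subst h
  refine ⟨fun i => (S.get (i.cast (List.length_map _))).2, ?_⟩
  unfold placement
  refine List.ext_getElem (by simp) fun i h1 h2 => ?_
  simp

end Cost

/-! ### Job lengths and the sampling grid -/

section LengthRatio

theorem sInf_len_le {L : List Job} {J : Job} (hJ : J ∈ L) :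
    sInf (Job.len '' {J | J ∈ L}) ≤ J.len :=
  csInf_le (L.finite_toSet.image _).bddBelow ⟨J, hJ, rfl⟩

theorem len_le_sSup {L : List Job} {J : Job} (hJ : J ∈ L) :
    J.len ≤ sSup (Job.len '' {J | J ∈ L}) :=
  le_csSup (L.finite_toSet.image _).bddAbove ⟨J, hJ, rfl⟩

theorem sInf_len_pos {L : List Job} (hne : L ≠ []) (hL : ∀ J ∈ L, J.start < J.finish) :
    0 < sInf (Job.len '' {J | J ∈ L}) := by
  obtain ⟨J, hJ⟩ := List.exists_mem_of_ne_nil L hne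
  have hS : (Job.len '' {J | J ∈ L}).Nonempty := ⟨_, J, hJ, rfl⟩
  obtain ⟨J', hJ', h⟩ := hS.csInf_mem (L.finite_toSet.image _)
  rw [← h]
  exact sub_pos.mpr (hL J' hJ')

theorem one_le_lengthRatio {L : List Job} (hne : L ≠ []) (hL : ∀ J ∈ L, J.start < J.finish) :
    1 ≤ lengthRatio L := by
  obtain ⟨J, hJ⟩ := List.exists_mem_of_ne_nil L hne
  unfold lengthRatio
  rw [one_le_div (sInf_len_pos hne hL)]
  exact (sInf_len_le hJ).trans (len_le_sSup hJ)

/-- A half-open interval of length at least `ℓ` that meets `(τ - 2 * u, τ]` contains one of the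
points `τ - k * ℓ` with `k ≤ ⌈2 * u / ℓ⌉`. -/
theorem exists_active_grid {J : Job} {ℓ u τ s : ℝ} (hℓ : 0 < ℓ) (hJ : ℓ ≤ J.len)
    (h1 : τ - 2 * u < s) (h2 : s ≤ τ) (hs : J.Active s) :
    ∃ k ∈ Finset.range (⌈2 * (u / ℓ)⌉₊ + 1), J.Active (τ - k * ℓ) := by
  unfold Job.len at hJ
  obtain ⟨h3, h4⟩ := hs
  rcases lt_or_ge τ J.finish with h | h
  · exact ⟨0, by simp, by simpa using h3.trans h2, by simpa using h⟩
  · have h0 : 0 ≤ (τ - J.finish) / ℓ := div_nonneg (by linarith) hℓ.le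
    -- The first grid point strictly before `J.finish`; the `+ 1` is needed because the interval
    -- excludes its right end.
    refine ⟨⌊(τ - J.finish) / ℓ⌋₊ + 1, ?_, ?_, ?_⟩
    · rw [Finset.mem_range, add_lt_add_iff_right, Nat.floor_lt h0]
      refine lt_of_lt_of_le ?_ (Nat.le_ceil _)
      rw [← mul_div_assoc]
      exact div_lt_div_of_pos_right (by linarith) hℓ
    · have := Nat.floor_le h0
      rw [le_div_iff₀ hℓ] at this
      push_cast
      linarith
    · have := Nat.lt_floor_add_one ((τ - J.finish) / ℓ)
      rw [div_lt_iff₀ hℓ] at this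
      push_cast
      linarith

end LengthRatio

/-! ### The competitive ratio -/

section Competitive

variable {M : ℕ} {g c r : Fin M → ℝ}

/-- An inversion of rounded rates would be by a factor of at least eight, more than the rounding
allows. -/
theorem rate_mono (hcm : StrictMono c)
    (hr : ∀ z, (∃ n : ℤ, r z = (8 : ℝ) ^ n) ∧ r z / 8 < c z ∧ c z ≤ r z) : Monotone r := by
  intro x y hxy
  by_contra! hlt
  have h1 := rate_le_div (fun z => (hr z).1) hlt
  have h2 := hcm.monotone hxy
  linarith [(hr x).2.1, (hr y).2.2]

theorem cost_algOnline_le [NeZero M] (hg : ∀ z, 0 < g z) (hgm : StrictMono g) (hc : ∀ z, 0 < c z)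
    (hcm : StrictMono c)
    (hr : ∀ z, (∃ n : ℤ, r z = (8 : ℝ) ^ n) ∧ r z / 8 < c z ∧ c z ≤ r z) {L : List Job}
    (hne : L ≠ []) (hL : ∀ J ∈ L, 0 < J.size ∧ (∃ z, J.size ≤ g z) ∧ J.start < J.finish)
    (hinv : Invariant g r L (algOnline g r L)) {S : Placement M} (hS : IsSchedule g L S) :
    cost c (algOnline g r L) ≤ 384 * lengthRatio L * cost c S := by
  obtain ⟨A, hA⟩ := exists_eq_placement hinv.map_fst
  obtain ⟨B, rfl⟩ := exists_eq_placement hS.1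
  rw [hA] at hinv ⊢
  have hlt : ∀ J ∈ L, J.start < J.finish := fun J hJ => (hL J hJ).2.2
  have hcmp : Comparison g r L.get A B :=
    { g_pos := hg
      g_mono := hgm
      r_pow := fun z => (hr z).1
      r_mono := rate_mono hcm hr
      inv := by rwa [List.ofFn_get]
      cap := hS.2
      size_pos := fun i => (hL _ (L.get_mem i)).1
      start_lt := fun i => hlt _ (L.get_mem i) }
  have hratio := one_le_lengthRatio hne hlt
  have hℓ := sInf_len_pos hne hlt
  set ℓ := sInf (Job.len '' {J | J ∈ L}) with hℓ_def
  set u := sSup (Job.len '' {J | J ∈ L}) with hu_def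
  set T := Finset.range (⌈2 * (u / ℓ)⌉₊ + 1) with hT
  have hpoint : ∀ t, rateAt r (placement L.get A) t ≤
      12 * ∑ k ∈ T, rateAt r (placement L.get B) (t - k * ℓ) := fun t =>
    (rateAt_le_sum_card hcmp.r_pos _ t).trans <|
      hcmp.sum_open_le_sampledRate (ℓ := u) (θ := fun k => t - k * ℓ)
        { len_le := fun i => len_le_sSup (L.get_mem i)
          covers := fun i s h1 h2 hs =>
            exists_active_grid hℓ (sInf_len_le (L.get_mem i)) h1 h2 hs }
  have hint : ∀ k ∈ T, MeasureTheory.Integrable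
      fun t => rateAt r (placement L.get B) (t - (k : ℝ) * ℓ) := fun k _ =>
    (integrable_rateAt r (placement L.get B)).comp_sub_right _
  have hcost : cost r (placement L.get A) ≤ 12 * (T.card * cost r (placement L.get B)) := by
    rw [← integral_rateAt]
    refine (MeasureTheory.integral_mono (integrable_rateAt r _)
      ((MeasureTheory.integrable_finsetSum _ hint).const_mul 12) hpoint).trans ?_
    rw [MeasureTheory.integral_const_mul, MeasureTheory.integral_finsetSum _ hint]
    simp only [MeasureTheory.integral_sub_right_eq_self (rateAt r (placement L.get B)),
      integral_rateAt, Finset.sum_const, nsmul_eq_mul]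
    exact le_rfl
  have h8 : cost r (placement L.get B) ≤ 8 * cost c (placement L.get B) := by
    rw [← cost_const_mul]
    exact cost_mono (fun z => by linarith [(hr z).2.1]) _
  -- `⌈2μ⌉ + 1 ≤ 2μ + 2 ≤ 4μ`, because `μ ≥ 1`. With the pointwise factor `12` and the rounding
  -- factor `8` this gives `384`.
  have hcard : (T.card : ℝ) ≤ 4 * lengthRatio L := by
    have h2 : lengthRatio L = u / ℓ := rfl
    have := Nat.ceil_lt_add_one (a := 2 * (u / ℓ)) (by rw [← h2]; linarith)
    rw [hT, Finset.card_range]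
    push_cast
    linarith
  have hnn := cost_nonneg hc (placement L.get B)
  calc cost c (placement L.get A) ≤ cost r (placement L.get A) := cost_mono (fun z => (hr z).2.2) _
    _ ≤ 12 * (T.card * cost r (placement L.get B)) := hcost
    _ ≤ 12 * (4 * lengthRatio L * (8 * cost c (placement L.get B))) := by
        have h1 := cost_nonneg hcmp.r_pos (placement L.get B)
        gcongr
    _ = 384 * lengthRatio L * cost c (placement L.get B) := by ring

end Competitive

end BSHM

theorem mainTheorem2 :
    ∃ C : ℝ, 0 < C ∧
      ∀ (M : ℕ) [NeZero M] (g c r : Fin M → ℝ),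
        (∀ z, 0 < g z) → StrictMono g →
        (∀ z, 0 < c z) → StrictMono c →
        (∀ z, (∃ n : ℤ, r z = (8 : ℝ) ^ n) ∧ r z / 8 < c z ∧ c z ≤ r z) →
        ∀ L : List BSHM.Job,
          (∀ J ∈ L, 0 < J.size ∧ (∃ z, J.size ≤ g z) ∧ J.start < J.finish) →
          L.Pairwise (fun J J' => J.start ≤ J'.start) →
          BSHM.IsSchedule g L (BSHM.algOnline g r L) ∧
          BSHM.cost c (BSHM.algOnline g r L) ≤
            C * BSHM.lengthRatio L * BSHM.opt g c L := by
  refine ⟨384, by norm_num, ?_⟩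
  intro M _ g c r hg hgm hc hcm hr L hL hsorted
  have hrpos : ∀ z, 0 < r z := fun z => (hc z).trans_le (hr z).2.2
  have hinv := BSHM.algOnline_invariant hg hgm hrpos L hL hsorted
  have hsched : BSHM.IsSchedule g L (BSHM.algOnline g r L) := ⟨hinv.map_fst, hinv.load_le⟩
  refine ⟨hsched, ?_⟩
  rcases eq_or_ne L [] with rfl | hne
  · have h1 : BSHM.lengthRatio [] = 0 := by simp [BSHM.lengthRatio]
    have h2 : BSHM.cost c (BSHM.algOnline g r []) = 0 := by
      simp [BSHM.cost, BSHM.algOnline]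
    rw [h1, h2]
    simp
  · have hpos : 0 < 384 * BSHM.lengthRatio L := by
      have := BSHM.one_le_lengthRatio hne fun J hJ => (hL J hJ).2.2
      linarith
    rw [← div_le_iff₀' hpos]
    -- The algorithm's own schedule shows that the infimum is over a nonempty set.
    refine le_csInf ⟨_, _, hsched, rfl⟩ ?_
    rintro _ ⟨S, hS, rfl⟩
    rw [div_le_iff₀' hpos]
    exact BSHM.cost_algOnline_le hg hgm hc hcm hr hne hL hinv hS
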